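/- Let $G$ be a finite undirected graph, possibly with loops and parallel edges, with edge set $E$, whose node set is a disjoint union $V\sqcup S\sqcup T$, where every node in $S$ (an input) and every node in $T$ (an output) has degree one. Let $c:E\to\mathbb N$, $e\mapsto c_e$, and suppose that for some integer $d>0$ every $c_e$ is a power $d^{k}$ with $k\ge 0$. For $u\in S\sqcup T$ let $e(u)$ be the edge at $u$. Let $V_S=\bigotimes_{s\in S}\mathbb C^{c_{e(s)}}$ and $V_T=\bigotimes_{t\in T}\mathbb C^{c_{e(t)}}$. A tensor assignment $\mathcal T$ gives each $v\in V$ a tensor $\mathcal T_v\in\bigotimes_h\mathbb C^{c_{e(h)}}$, where $h$ runs over the edge ends at $v$ (a loop has two) and $e(h)$ is the edge of $h$. Contraction yields the vector $$\alpha(\mathcal T)=\sum_{I,J}C_{IJ}\,|I\rangle_S|J\rangle_T\in V_S\otimes V_T,\qquad C_{IJ}=\sum_{W}\ \prod_{v\in V}\langle W_{|v}|\mathcal T_v\rangle,$$ where $I$ and $J$ run over the multi-indices of the input and the output ends, $W$ runs over all choices of one index in $\{1,\dots,c_e\}$ for each edge $e$ that agree with $I$ and $J$ at the inputs and the outputs,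 and $W_{|v}$ is the multi-index read off at $v$. If $\alpha(\mathcal T)\ne 0$, let $\mathrm{EE}(\mathcal T)$ be the entanglement entropy between $V_S$ and $V_T$ of the normalized state $\alpha(\mathcal T)/\|\alpha(\mathcal T)\|$, that is, $-\sum_i\lambda_i\log\lambda_i$ (with $0\log 0=0$), where the $\lambda_i$ are the eigenvalues of $\rho_S=CC^\dagger/\operatorname{Tr}(CC^\dagger)$, counted with multiplicity. Let $\mathrm{QMC}(G,c)$ be the minimum of $\prod_{e\in C}c_e$ over all edge cut sets $C$, that is, over the sets $C$ of all edges between $\bar S$ and $\bar T$ for a partition $V\sqcup S\sqcup T=\bar S\sqcup\bar T$ with $S\subset\bar S$ and $T\subset\bar T$. Then $$\max_{\mathcal T:\ \alpha(\mathcal T)\ne 0}\mathrm{EE}(\mathcal T)=\log \mathrm{QMC}(G,c),$$ and the maximum is attained at a tensor assignment all of whose tensors have only entries $0$ and $1$ in the standard basis. -/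

import Mathlib

/-- A finite undirected graph (loops and parallel edges are allowed) with vertex set `V`, set of
inputs `S`, set of outputs `T` and edge set `E`. Every edge `e` has the two ends `(e, false)` and
`(e, true)`, and `att` says to which node an edge end is attached: to a vertex in `V`, or to an
input or output. Each input and output `u` has degree one: `openEnd u` is the only edge end that
is attached to it. -/
structure OpenGraph (V S T E : Type*) where
  att : E × Bool → V ⊕ (S ⊕ T)
  openEnd : S ⊕ T → E × Bool
  att_eq_inr_iff : ∀ (h : E × Bool) (u : S ⊕ T), att h = Sum.inr u ↔ h = openEnd u

namespace OpenGraph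

variable {V S T E : Type*}

/-- The edge ends at the vertex `v`. A loop at `v` contributes both of its ends. -/
abbrev EndsAt (G : OpenGraph V S T E) (v : V) : Type _ :=
  {h : E × Bool // G.att h = Sum.inl v}

/-- The input edge whose open end is `s`. -/
def inEdge (G : OpenGraph V S T E) (s : S) : E := (G.openEnd (Sum.inl s)).1

/-- The output edge whose open end is `t`. -/
def outEdge (G : OpenGraph V S T E) (t : T) : E := (G.openEnd (Sum.inr t)).1

/-- Multi-indices for the inputs: they label the standard basis of `V_S = ⨂ ℂ^(c_{e(s)})`. -/
abbrev InIdx (G : OpenGraph V S T E) (c : E → ℕ) : Type _ := (s : S) → Fin (c (G.inEdge s))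

/-- Multi-indices for the outputs: they label the standard basis of `V_T = ⨂ ℂ^(c_{e(t)})`. -/
abbrev OutIdx (G : OpenGraph V S T E) (c : E → ℕ) : Type _ := (t : T) → Fin (c (G.outEdge t))

/-- A tensor assignment: at every vertex `v` a tensor in `⨂ ℂ^(c_e)`, with one factor for each
edge end at `v`, given by its coordinates in the standard basis. -/
abbrev TensorAssignment (G : OpenGraph V S T E) (c : E → ℕ) : Type _ :=
  (v : V) → ((h : G.EndsAt v) → Fin (c h.1.1)) → ℂ

/-- The multi-index `W` for all edges extends the input multi-index `I` and the output
multi-index `J`. -/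
abbrev Extends (G : OpenGraph V S T E) (c : E → ℕ) (W : (e : E) → Fin (c e))
    (I : G.InIdx c) (J : G.OutIdx c) : Prop :=
  (∀ s, W (G.inEdge s) = I s) ∧ (∀ t, W (G.outEdge t) = J t)

/-- The result of contracting the tensor network: the matrix `C` of coordinates of
`α = ∑ C I J |I⟩|J⟩` in `V_S ⊗ V_T`, with
`C I J = ∑_{W extending I, J} ∏_v ⟨W restricted to v | 𝒯_v⟩`. -/
def contract [Fintype V] [Fintype S] [Fintype T] [Fintype E] [DecidableEq E]
    (G : OpenGraph V S T E) (c : E → ℕ) (𝒯 : G.TensorAssignment c) :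
    Matrix (G.InIdx c) (G.OutIdx c) ℂ :=
  fun I J => ∑ W : ((e : E) → Fin (c e)) with G.Extends c W I J,
    ∏ v : V, 𝒯 v (fun h => W h.1.1)

/-- `C` is an edge cut set: all nodes (vertices, inputs, outputs) are divided into two sides, with
all inputs on one side and all outputs on the other, and `C` is the set of edges whose two ends
lie on different sides. -/
def IsEdgeCut (G : OpenGraph V S T E) (C : Finset E) : Prop :=
  ∃ side : V ⊕ (S ⊕ T) → Bool,
    (∀ s : S, side (Sum.inr (Sum.inl s)) = true) ∧
    (∀ t : T, side (Sum.inr (Sum.inr t)) = false) ∧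
    ∀ e : E, e ∈ C ↔ side (G.att (e, false)) ≠ side (G.att (e, true))

/-- The quantum min-cut: the minimum of `∏_{e ∈ C} c e` over all edge cut sets `C`. -/
noncomputable def quantumMinCut (G : OpenGraph V S T E) (c : E → ℕ) : ℕ :=
  sInf {m : ℕ | ∃ C : Finset E, G.IsEdgeCut C ∧ m = ∏ e ∈ C, c e}

/-- Edge cut sets exist, so the quantum min-cut is a minimum over a non-empty set. -/
theorem exists_isEdgeCut [Fintype E] (G : OpenGraph V S T E) :
    ∃ C : Finset E, G.IsEdgeCut C := by
  let side : V ⊕ (S ⊕ T) → Bool := Sum.elim (fun _ => true) (Sum.elim (fun _ => true) fun _ => false)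
  exact ⟨Finset.univ.filter (fun e => side (G.att (e, false)) ≠ side (G.att (e, true))),
    side, fun _ => rfl, fun _ => rfl, fun e => by simp⟩

end OpenGraph

section Entropy

variable {A B : Type*} [Fintype B]

/-- The von Neumann entropy `-∑ λ log λ` of a density matrix with eigenvalues `λ` (counted with
multiplicity), with `0 log 0 = 0`. -/
noncomputable def vonNeumannEntropy [Fintype A] [DecidableEq A] (ρ : Matrix A A ℂ) (hρ : ρ.IsHermitian) : ℝ :=
  ∑ i, Real.negMulLog (hρ.eigenvalues i)

/-- The vector `∑ C i j |i⟩|j⟩` divided by its norm `√(∑ |C i j|²) = √(Tr (C C†))`. -/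
noncomputable def normalizedState [Fintype A] (C : Matrix A B ℂ) : Matrix A B ℂ :=
  (((√(∑ i, ∑ j, ‖C i j‖ ^ 2))⁻¹ : ℝ) : ℂ) • C

/-- The reduced density matrix on the first factor of the pure state `∑ ψ i j |i⟩|j⟩`: the
partial trace of `|ψ⟩⟨ψ|` over the second factor. -/
def reducedDensity (ψ : Matrix A B ℂ) : Matrix A A ℂ :=
  fun i i' => ∑ j, ψ i j * star (ψ i' j)

theorem reducedDensity_isHermitian (ψ : Matrix A B ℂ) : (reducedDensity ψ).IsHermitian :=
  Matrix.isHermitian_mul_conjTranspose_self ψ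

/-- The entanglement entropy, between the two factors, of the pure state that is proportional to
the non-zero vector `∑ C i j |i⟩|j⟩`. -/
noncomputable def entanglementEntropy [Fintype A] [DecidableEq A] (C : Matrix A B ℂ) : ℝ :=
  vonNeumannEntropy (reducedDensity (normalizedState C))
    (reducedDensity_isHermitian (normalizedState C))

end Entropy

/-- The entanglement entropies between inputs and outputs, over all tensor assignments for which
the contracted tensor is non-zero, so that it can be normalized to a state. -/
def OpenGraph.entropyValues {V S T E : Type*} [Fintype V] [Fintype S] [Fintype T] [Fintype E]
    [DecidableEq S] [DecidableEq T] [DecidableEq E] (G : OpenGraph V S T E) (c : E → ℕ) : Set ℝ :=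
  {x : ℝ | ∃ 𝒯 : G.TensorAssignment c,
    G.contract c 𝒯 ≠ 0 ∧ x = entanglementEntropy (G.contract c 𝒯)}

/-! ### Entropy, rank and flat spectra. -/

section EntropyBounds

open Matrix
open scoped ComplexOrder

variable {A B : Type*} [Fintype A] [Fintype B]

/-! Upper bound: the contraction matrix factors through the multi-indices on the edges of any cut,
so its rank is at most the cut product (`rank_contract_le`), and entropy is at most the log of the
rank (`entanglementEntropy_le_log_of_rank_le`).

Lower bound: an edge with c_e = d^k_e is a bundle of k_e unit edges, each carrying a letter of F =
ZMod d. Let m be the least sum of k_e over cuts. A Hall-type Menger theorem (`exists_linking`), fed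
by the cut inequality `card_add_le_of_isEdgeCut`, links at least m input unit edges to output ones
by disjoint chains. The 0-1 tensors force labels to be constant along the chains. The admissible
labelings form a finite abelian group K, and the contraction is aᴴ * b for the 0-1 matrices of the
two boundary maps on K, whose fibres are the cosets of subgroups Ha and Hb. This is a multiple of a
partial isometry, so the spectrum is flat and the entropy is log |K/(Ha+Hb)|. Reading the letters at
the linked inputs P maps K onto F^P and kills Ha and Hb, so the entropy is at least m log d, which
is at least the log of the quantum min-cut. -/

theorem reducedDensity_normalizedState (C : Matrix A B ℂ) :
    reducedDensity (normalizedState C) =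
      (((∑ i, ∑ j, ‖C i j‖ ^ 2)⁻¹ : ℝ) : ℂ) • (C * Cᴴ) := by
  have hN : (0 : ℝ) ≤ ∑ i, ∑ j, ‖C i j‖ ^ 2 := by positivity
  ext i i'
  simp only [reducedDensity, normalizedState, Matrix.smul_apply, Matrix.mul_apply, smul_eq_mul,
    Matrix.conjTranspose_apply, Finset.mul_sum, star_mul', Complex.star_def, Complex.conj_ofReal]
  refine Finset.sum_congr rfl fun j _ => ?_
  rw [← Real.mul_self_sqrt hN, mul_inv, Complex.ofReal_mul, Real.mul_self_sqrt hN]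
  ring

theorem trace_mul_conjTranspose_eq_sum (C : Matrix A B ℂ) :
    (C * Cᴴ).trace = ((∑ i, ∑ j, ‖C i j‖ ^ 2 : ℝ) : ℂ) := by
  simp only [Matrix.trace, Matrix.diag_apply, Matrix.mul_apply, Matrix.conjTranspose_apply]
  push_cast
  refine Finset.sum_congr rfl fun i _ => Finset.sum_congr rfl fun j _ => ?_
  rw [Complex.star_def, Complex.mul_conj, Complex.normSq_eq_norm_sq]
  push_cast; rfl

theorem sum_norm_sq_pos {C : Matrix A B ℂ} (hC : C ≠ 0) : 0 < ∑ i, ∑ j, ‖C i j‖ ^ 2 := by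
  obtain ⟨i, j, hij⟩ : ∃ i j, C i j ≠ 0 := by
    by_contra! h
    exact hC (Matrix.ext h)
  refine Finset.sum_pos' (fun i _ => by positivity) ⟨i, Finset.mem_univ _, ?_⟩
  exact Finset.sum_pos' (fun i _ => by positivity) ⟨j, Finset.mem_univ _, by positivity⟩

variable [DecidableEq A]

theorem sum_eigenvalues_reducedDensity {C : Matrix A B ℂ} (hC : C ≠ 0) :
    ∑ i, (reducedDensity_isHermitian (normalizedState C)).eigenvalues i = 1 := by
  have h := (reducedDensity_isHermitian (normalizedState C)).trace_eq_sum_eigenvalues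
  have h1 : (reducedDensity (normalizedState C)).trace = 1 := by
    rw [reducedDensity_normalizedState, Matrix.trace_smul, trace_mul_conjTranspose_eq_sum,
      smul_eq_mul, ← Complex.ofReal_mul, inv_mul_cancel₀ (sum_norm_sq_pos hC).ne',
      Complex.ofReal_one]
  rw [h1, ← RCLike.ofReal_sum, ← RCLike.ofReal_one (K := ℂ), RCLike.ofReal_inj] at h
  exact h.symm

theorem eigenvalues_reducedDensity_nonneg (ψ : Matrix A B ℂ) (i : A) :
    0 ≤ (reducedDensity_isHermitian ψ).eigenvalues i :=
  (Matrix.posSemidef_self_mul_conjTranspose ψ).eigenvalues_nonneg i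

theorem entanglementEntropy_le_log_of_rank_le {C : Matrix A B ℂ} (hC : C ≠ 0) {N : ℕ}
    (hN : C.rank ≤ N) : entanglementEntropy C ≤ Real.log N := by
  set h := reducedDensity_isHermitian (normalizedState C) with hh
  have hsum := sum_eigenvalues_reducedDensity hC
  have hrank : (Finset.univ.filter fun i => h.eigenvalues i ≠ 0).card ≤ N := by
    rw [← Fintype.card_subtype, ← h.rank_eq_card_non_zero_eigs, reducedDensity_normalizedState]
    refine le_trans ?_ hN
    rw [← Matrix.smul_mul]
    refine (Matrix.rank_mul_le_left _ _).trans ?_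
    classical
    rw [show ((((∑ i, ∑ j, ‖C i j‖ ^ 2)⁻¹ : ℝ) : ℂ) • C) =
      C * ((((∑ i, ∑ j, ‖C i j‖ ^ 2)⁻¹ : ℝ) : ℂ) • (1 : Matrix B B ℂ)) by simp]
    exact Matrix.rank_mul_le_left _ _
  have hpos : 0 < N := by
    rcases Nat.eq_zero_or_pos N with rfl | h0
    · have : ∀ i, h.eigenvalues i = 0 := by
        simpa [Finset.filter_eq_empty_iff] using hrank
      rw [← hh] at hsum
      simp [this] at hsum
    · exact h0
  have hN' : (0 : ℝ) < N := by exact_mod_cast hpos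
  have key : ∀ i, Real.negMulLog (h.eigenvalues i) ≤
      h.eigenvalues i * Real.log N - h.eigenvalues i +
        (if h.eigenvalues i ≠ 0 then (N : ℝ)⁻¹ else 0) := by
    intro i
    rcases (eigenvalues_reducedDensity_nonneg (normalizedState C) i).eq_or_lt with h0 | h0
    · simp [← h0]
    · change 0 < h.eigenvalues i at h0
      rw [if_pos h0.ne']
      -- The tangent inequality at x = 1/(λN) is sharp at the flat value λ = 1/N. Summed over at
      -- most N nonzero eigenvalues, the terms 1/N give at most 1, which cancels -∑ λ.
      have hl := Real.log_le_sub_one_of_pos (x := (h.eigenvalues i * N)⁻¹) (by positivity)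
      rw [Real.log_inv, Real.log_mul h0.ne' hN'.ne'] at hl
      have := mul_le_mul_of_nonneg_left hl h0.le
      have e : h.eigenvalues i * ((h.eigenvalues i * N)⁻¹ - 1) = (N : ℝ)⁻¹ - h.eigenvalues i := by
        field_simp
      rw [e] at this
      rw [Real.negMulLog]
      linarith
  calc entanglementEntropy C = ∑ i, Real.negMulLog (h.eigenvalues i) := rfl
    _ ≤ _ := Finset.sum_le_sum fun i _ => key i
    _ = Real.log N - 1 + (Finset.univ.filter fun i => h.eigenvalues i ≠ 0).card * (N : ℝ)⁻¹ := by
      rw [Finset.sum_add_distrib, Finset.sum_sub_distrib, ← Finset.sum_mul, hsum,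
        ← Finset.sum_filter, Finset.sum_const, nsmul_eq_mul, one_mul]
    _ ≤ Real.log N - 1 + N * (N : ℝ)⁻¹ := by gcongr
    _ = Real.log N := by rw [mul_inv_cancel₀ hN'.ne']; ring

/-- If `C` is a multiple of a partial isometry, then its reduced density matrix has a flat
spectrum. -/
theorem entanglementEntropy_eq_log_of_mul_conjTranspose_mul_self {C : Matrix A B ℂ} {γ D : ℝ}
    (hγ : 0 < γ) (hD : 0 < D) (hC : C * Cᴴ * C = (γ : ℂ) • C)
    (hnorm : ∑ i, ∑ j, ‖C i j‖ ^ 2 = D * γ) : entanglementEntropy C = Real.log D := by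
  have hC0 : C ≠ 0 := by
    rintro rfl
    simp at hnorm
    exact hnorm.elim hD.ne' hγ.ne'
  set h := reducedDensity_isHermitian (normalizedState C) with hh
  have hsum := sum_eigenvalues_reducedDensity hC0
  -- From ρ² = ρ/D every eigenvalue is 0 or 1/D.
  have hsq : reducedDensity (normalizedState C) * reducedDensity (normalizedState C) =
      ((D⁻¹ : ℝ) : ℂ) • reducedDensity (normalizedState C) := by
    rw [reducedDensity_normalizedState, hnorm, Matrix.smul_mul, Matrix.mul_smul,
      ← Matrix.mul_assoc, hC, Matrix.smul_mul, smul_smul, smul_smul, smul_smul]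
    congr 1
    rw [← Complex.ofReal_mul, ← Complex.ofReal_mul, ← Complex.ofReal_mul]
    congr 1
    field_simp
  have heig : ∀ i, h.eigenvalues i * h.eigenvalues i = D⁻¹ * h.eigenvalues i := by
    intro i
    have h1 := h.mulVec_eigenvectorBasis i
    have h2 := congrArg (fun M => M *ᵥ ⇑(h.eigenvectorBasis i)) hsq
    simp only [← Matrix.mulVec_mulVec, h1, Matrix.mulVec_smul, Matrix.smul_mulVec] at h2
    have hne : (h.eigenvectorBasis i : EuclideanSpace ℂ A) ≠ 0 := by
      intro h0
      have := h.eigenvectorBasis.orthonormal.1 i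
      simp [h0] at this
    obtain ⟨j, hj⟩ : ∃ j, h.eigenvectorBasis i j ≠ 0 := by
      by_contra! h0
      exact hne (by ext j; exact h0 j)
    have h3 := congrFun h2 j
    simp only [Pi.smul_apply, Complex.real_smul, smul_eq_mul, ← mul_assoc] at h3
    have h4 := mul_right_cancel₀ hj h3
    exact Complex.ofReal_injective (by push_cast; simpa using h4)
  have key : ∀ i, Real.negMulLog (h.eigenvalues i) = h.eigenvalues i * Real.log D := by
    intro i
    rcases eq_or_ne (h.eigenvalues i) 0 with h0 | h0
    · simp [h0]
    · rw [mul_right_cancel₀ h0 (heig i), Real.negMulLog, Real.log_inv]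
      ring
  calc entanglementEntropy C = ∑ i, Real.negMulLog (h.eigenvalues i) := rfl
    _ = _ := Finset.sum_congr rfl fun i _ => key i
    _ = Real.log D := by rw [← Finset.sum_mul, hsum, one_mul]

end EntropyBounds

/-! ### Factorization of the contraction through a cut. -/

namespace OpenGraph

variable {V S T E : Type*}

theorem att_openEnd (G : OpenGraph V S T E) (u : S ⊕ T) : G.att (G.openEnd u) = Sum.inr u :=
  (G.att_eq_inr_iff _ _).2 rfl

/-- Multi-indices for the edges correspond to triples of multi-indices for the edges in `C`, for
the other edges with `σ e = true`, and for those with `σ e = false`. -/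
def splitIdx [DecidableEq E] (c : E → ℕ) (C : Finset E) (σ : E → Bool) :
    ((e : E) → Fin (c e)) ≃ ((e : {e // e ∈ C}) → Fin (c e)) ×
      ((e : {e // e ∉ C ∧ σ e = true}) → Fin (c e)) ×
      ((e : {e // e ∉ C ∧ σ e = false}) → Fin (c e)) where
  toFun W := (fun e => W e, fun e => W e, fun e => W e)
  invFun w e :=
    if h : e ∈ C then w.1 ⟨e, h⟩
    else if h' : σ e = true then w.2.1 ⟨e, h, h'⟩
    else w.2.2 ⟨e, h, by simpa using h'⟩
  left_inv W := by
    funext e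
    by_cases h : e ∈ C <;> by_cases h' : σ e = true <;> simp [h, h']
  right_inv w := by
    obtain ⟨w, u, z⟩ := w
    refine Prod.ext ?_ (Prod.ext ?_ ?_)
    · funext e; simp [e.2]
    · funext e; simp [e.2.1, e.2.2]
    · funext e; simp [e.2.1, e.2.2]

/-- The contribution of one side of a cut to the contraction of a tensor network. -/
noncomputable def sideFactor [Fintype V] (G : OpenGraph V S T E) (c : E → ℕ) (𝒯 : G.TensorAssignment c)
    (p : V → Prop) [DecidablePred p] (W : (e : E) → Fin (c e)) : ℂ :=
  ∏ v : V with p v, 𝒯 v (fun h => W h.1.1)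

theorem sideFactor_congr [Fintype V] (G : OpenGraph V S T E) (c : E → ℕ) (𝒯 : G.TensorAssignment c)
    (p : V → Prop) [DecidablePred p] {W W' : (e : E) → Fin (c e)}
    (h : ∀ x v, G.att x = Sum.inl v → p v → W x.1 = W' x.1) :
    G.sideFactor c 𝒯 p W = G.sideFactor c 𝒯 p W' := by
  refine Finset.prod_congr rfl fun v hv => ?_
  congr 1
  funext x
  exact h x.1 v x.2 (Finset.mem_filter.1 hv).2

/-- Each side of the cut sees only the labels on cut edges and on its own inner edges. Once the cut
labels are fixed, the sum over the remaining labels splits into a product, so the cut labels become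
the middle index of a matrix product. -/
theorem rank_contract_le [Fintype V] [Fintype S] [Fintype T] [Fintype E]
    [DecidableEq S] [DecidableEq T] [DecidableEq E]
    (G : OpenGraph V S T E) (c : E → ℕ) (hc : ∀ e, 0 < c e) (𝒯 : G.TensorAssignment c) {C : Finset E} (hC : G.IsEdgeCut C) :
    (G.contract c 𝒯).rank ≤ ∏ e ∈ C, c e := by
  obtain ⟨side, hS, hT, hcut⟩ := hC
  let σ : E → Bool := fun e => side (G.att (e, false))
  have hσ : ∀ x : E × Bool, x.1 ∉ C → σ x.1 = side (G.att x) := by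
    rintro ⟨e, b⟩ hx
    have := (hcut e).not.1 hx
    rw [not_not] at this
    cases b
    · rfl
    · exact this
  let eq := splitIdx c C σ
  have glue_true : ∀ w u z z' x, side (G.att x) = true →
      eq.symm (w, u, z) x.1 = eq.symm (w, u, z') x.1 := by
    intro w u z z' x hx
    by_cases h : x.1 ∈ C
    · simp [eq, splitIdx, h]
    · have := (hσ x h).trans hx
      simp [eq, splitIdx, h, this]
  have glue_false : ∀ w u u' z x, side (G.att x) = false →
      eq.symm (w, u, z) x.1 = eq.symm (w, u', z) x.1 := by
    intro w u u' z x hx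
    by_cases h : x.1 ∈ C
    · simp [eq, splitIdx, h]
    · have := (hσ x h).trans hx
      simp [eq, splitIdx, h, this]
  let L : G.InIdx c → ((e : E) → Fin (c e)) → ℂ := fun I W =>
    (if ∀ s, W (G.inEdge s) = I s then 1 else 0) *
      G.sideFactor c 𝒯 (fun v => side (Sum.inl v) = true) W
  let R : G.OutIdx c → ((e : E) → Fin (c e)) → ℂ := fun J W =>
    (if ∀ t, W (G.outEdge t) = J t then 1 else 0) *
      G.sideFactor c 𝒯 (fun v => ¬ side (Sum.inl v) = true) W
  -- Arbitrary fillers for the coordinates that a side does not see; they exist because `c` is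
  -- positive.
  let z₀ : (e : {e // e ∉ C ∧ σ e = false}) → Fin (c e) := fun e => ⟨0, hc e⟩
  let u₀ : (e : {e // e ∉ C ∧ σ e = true}) → Fin (c e) := fun e => ⟨0, hc e⟩
  have hL : ∀ I w u z, L I (eq.symm (w, u, z)) = L I (eq.symm (w, u, z₀)) := by
    intro I w u z
    simp only [L]
    congr 1
    · have : ∀ s, eq.symm (w, u, z) (G.inEdge s) = eq.symm (w, u, z₀) (G.inEdge s) := fun s =>
        glue_true w u z z₀ (G.openEnd (Sum.inl s)) (by rw [att_openEnd, hS])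
      simp only [this]
    · exact sideFactor_congr G c 𝒯 _ fun x v hx hv => glue_true w u z z₀ x (by rw [hx, hv])
  have hR : ∀ J w u z, R J (eq.symm (w, u, z)) = R J (eq.symm (w, u₀, z)) := by
    intro J w u z
    simp only [R]
    congr 1
    · have : ∀ t, eq.symm (w, u, z) (G.outEdge t) = eq.symm (w, u₀, z) (G.outEdge t) := fun t =>
        glue_false w u u₀ z (G.openEnd (Sum.inr t)) (by rw [att_openEnd, hT])
      simp only [this]
    · exact sideFactor_congr G c 𝒯 _ fun x v hx hv =>
        glue_false w u u₀ z x (by rw [hx]; simpa using hv)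
  let P : Matrix (G.InIdx c) ((e : {e // e ∈ C}) → Fin (c e)) ℂ := fun I w =>
    ∑ u, L I (eq.symm (w, u, z₀))
  let Q : Matrix ((e : {e // e ∈ C}) → Fin (c e)) (G.OutIdx c) ℂ := fun w J =>
    ∑ z, R J (eq.symm (w, u₀, z))
  have hfac : G.contract c 𝒯 = P * Q := by
    ext I J
    calc G.contract c 𝒯 I J = ∑ W : ((e : E) → Fin (c e)), L I W * R J W := by
          rw [contract, Finset.sum_filter]
          refine Finset.sum_congr rfl fun W _ => ?_
          simp only [L, R, sideFactor]
          rw [mul_mul_mul_comm, Finset.prod_filter_mul_prod_filter_not]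
          by_cases h1 : ∀ s, W (G.inEdge s) = I s <;>
            by_cases h2 : ∀ t, W (G.outEdge t) = J t <;> simp [h1, h2]
      _ = ∑ p, L I (eq.symm p) * R J (eq.symm p) := (Equiv.sum_comp eq.symm _).symm
      _ = (P * Q) I J := by
          rw [Fintype.sum_prod_type, Matrix.mul_apply]
          refine Finset.sum_congr rfl fun w _ => ?_
          rw [Fintype.sum_prod_type, Finset.sum_mul_sum]
          refine Finset.sum_congr rfl fun u _ => Finset.sum_congr rfl fun z _ => ?_
          rw [hL, hR]
  calc (G.contract c 𝒯).rank ≤ P.rank := by rw [hfac]; exact Matrix.rank_mul_le_left _ _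
    _ ≤ Fintype.card ((e : {e // e ∈ C}) → Fin (c e)) := Matrix.rank_le_card_width _
    _ = ∏ e ∈ C, c e := by
      simp only [Fintype.card_pi, Fintype.card_fin]
      exact Finset.prod_coe_sort C c

end OpenGraph

/-! ### Coset matrices of finite abelian groups. -/

section SubgroupMatrix

open Matrix

variable {K A B : Type*} [AddCommGroup K] [DecidableEq A] [DecidableEq B]

/-- The 0-1 matrix of a function. -/
def graphMatrix (a : K → A) : Matrix K A ℂ := fun k i => if a k = i then 1 else 0

open Classical in
/-- The 0-1 matrix of the partition of a group into the cosets of a subgroup. -/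
noncomputable def cosetMatrix (H : AddSubgroup K) : Matrix K K ℂ :=
  fun k l => if k - l ∈ H then 1 else 0

theorem graphMatrix_mul_conjTranspose [Fintype A] (a : K → A) (H : AddSubgroup K)
    (ha : ∀ k l, a k = a l ↔ k - l ∈ H) :
    graphMatrix a * (graphMatrix a)ᴴ = cosetMatrix H := by
  ext k l
  simp only [Matrix.mul_apply, Matrix.conjTranspose_apply, graphMatrix, cosetMatrix, ← ha]
  simp [eq_comm]

theorem cosetMatrix_conjTranspose (H : AddSubgroup K) : (cosetMatrix H)ᴴ = cosetMatrix H := by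
  ext k l
  simp only [Matrix.conjTranspose_apply, cosetMatrix]
  rw [← neg_sub, H.neg_mem_iff]
  split_ifs <;> simp

/-- Both are convolution operators on an abelian group; the reflection x ↦ k + l - x exchanges the
factors. -/
theorem cosetMatrix_mul_comm [Fintype K] (H H' : AddSubgroup K) :
    cosetMatrix H * cosetMatrix H' = cosetMatrix H' * cosetMatrix H := by
  ext k l
  simp only [Matrix.mul_apply, cosetMatrix]
  refine Fintype.sum_equiv (Equiv.subLeft (k + l)) _ _ fun x => ?_
  rw [Equiv.subLeft_apply, mul_comm, show k - (k + l - x) = x - l by abel, show k + l - x - l = k - x by abel]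

theorem sum_cosetMatrix [Fintype K] (H : AddSubgroup K) (k : K) :
    ∑ l, cosetMatrix H k l = Nat.card H := by
  classical
  rw [← Equiv.sum_comp (Equiv.subLeft k)]
  simp [cosetMatrix, Nat.card_eq_fintype_card, Fintype.card_subtype]

theorem cosetMatrix_mul_graphMatrix [Fintype K] (a : K → A) (H : AddSubgroup K)
    (ha : ∀ k l, a k = a l ↔ k - l ∈ H) :
    cosetMatrix H * graphMatrix a = (Nat.card H : ℂ) • graphMatrix a := by
  ext k i
  rw [Matrix.mul_apply, Matrix.smul_apply, ← sum_cosetMatrix H k, smul_eq_mul, Finset.sum_mul]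
  refine Finset.sum_congr rfl fun l _ => ?_
  by_cases h : k - l ∈ H
  · simp only [graphMatrix, (ha k l).2 h]
  · simp [cosetMatrix, h]

theorem conjTranspose_graphMatrix_mul_cosetMatrix [Fintype K] (a : K → A) (H : AddSubgroup K)
    (ha : ∀ k l, a k = a l ↔ k - l ∈ H) :
    (graphMatrix a)ᴴ * cosetMatrix H = (Nat.card H : ℂ) • (graphMatrix a)ᴴ := by
  have := congrArg Matrix.conjTranspose (cosetMatrix_mul_graphMatrix a H ha)
  simpa [Matrix.conjTranspose_mul, cosetMatrix_conjTranspose, Matrix.conjTranspose_smul] using this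

theorem trace_cosetMatrix_mul [Fintype K] (H H' : AddSubgroup K) :
    (cosetMatrix H * cosetMatrix H').trace = Nat.card K * Nat.card (H ⊓ H' : AddSubgroup K) := by
  simp only [Matrix.trace, Matrix.diag_apply, Matrix.mul_apply]
  have : ∀ k l, cosetMatrix H k l * cosetMatrix H' l k = cosetMatrix (H ⊓ H') k l := by
    intro k l
    simp only [cosetMatrix, AddSubgroup.mem_inf]
    rw [← neg_sub k l, H'.neg_mem_iff]
    by_cases h : k - l ∈ H <;> by_cases h' : k - l ∈ H' <;> simp [h, h']
  simp only [this, sum_cosetMatrix]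
  simp

/-- The inner products b bᴴ and a aᴴ are coset matrices. They commute, so each can be moved next to
its own map, where it acts as the order of its subgroup. -/
theorem conjTranspose_graphMatrix_mul_mul_conjTranspose_mul_self [Fintype K] [Fintype A] [Fintype B]
    (a : K → A) (b : K → B) (Ha Hb : AddSubgroup K)
    (ha : ∀ k l, a k = a l ↔ k - l ∈ Ha) (hb : ∀ k l, b k = b l ↔ k - l ∈ Hb) :
    ((graphMatrix a)ᴴ * graphMatrix b) * ((graphMatrix a)ᴴ * graphMatrix b)ᴴ *
      ((graphMatrix a)ᴴ * graphMatrix b) =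
      ((Nat.card Ha * Nat.card Hb : ℝ) : ℂ) • ((graphMatrix a)ᴴ * graphMatrix b) := by
  calc _ = (graphMatrix a)ᴴ * ((graphMatrix b * (graphMatrix b)ᴴ) *
        (graphMatrix a * (graphMatrix a)ᴴ)) * graphMatrix b := by
        simp only [Matrix.conjTranspose_mul, Matrix.conjTranspose_conjTranspose, Matrix.mul_assoc]
    _ = ((graphMatrix a)ᴴ * cosetMatrix Ha) * (cosetMatrix Hb * graphMatrix b) := by
        rw [graphMatrix_mul_conjTranspose a Ha ha, graphMatrix_mul_conjTranspose b Hb hb,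
          cosetMatrix_mul_comm]
        simp only [Matrix.mul_assoc]
    _ = _ := by
        rw [conjTranspose_graphMatrix_mul_cosetMatrix a Ha ha, cosetMatrix_mul_graphMatrix b Hb hb,
          Matrix.smul_mul, Matrix.mul_smul, smul_smul]
        push_cast
        rfl

theorem sum_norm_sq_conjTranspose_graphMatrix_mul [Fintype K] [Fintype A] [Fintype B]
    (a : K → A) (b : K → B) (Ha Hb : AddSubgroup K)
    (ha : ∀ k l, a k = a l ↔ k - l ∈ Ha) (hb : ∀ k l, b k = b l ↔ k - l ∈ Hb) :
    ∑ i, ∑ j, ‖((graphMatrix a)ᴴ * graphMatrix b) i j‖ ^ 2 =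
      Nat.card K * Nat.card (Ha ⊓ Hb : AddSubgroup K) := by
  apply Complex.ofReal_injective
  rw [← trace_mul_conjTranspose_eq_sum, Matrix.conjTranspose_mul,
    Matrix.conjTranspose_conjTranspose, Matrix.mul_assoc, Matrix.trace_mul_comm,
    Matrix.mul_assoc, Matrix.mul_assoc, ← Matrix.mul_assoc, graphMatrix_mul_conjTranspose a Ha ha,
    graphMatrix_mul_conjTranspose b Hb hb, trace_cosetMatrix_mul, inf_comm]
  push_cast
  rfl

/-- The addition map Ha × Hb → K has image Ha + Hb inside ker φ, and its kernel embeds in Ha ⊓ Hb.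
-/
theorem card_mul_card_mul_card_le [Finite K] {X : Type*} [AddCommGroup X]
    (Ha Hb : AddSubgroup K) (φ : K →+ X)
    (hφ : Function.Surjective φ) (h1 : Ha ≤ φ.ker) (h2 : Hb ≤ φ.ker) :
    Nat.card X * (Nat.card Ha * Nat.card Hb) ≤
      Nat.card K * Nat.card (Ha ⊓ Hb : AddSubgroup K) := by
  let ψ : Ha × Hb →+ K := Ha.subtype.coprod Hb.subtype
  have hψ : Nat.card ψ.ker * Nat.card ψ.range = Nat.card Ha * Nat.card Hb := by
    rw [← AddSubgroup.index_ker, AddSubgroup.card_mul_index, Nat.card_prod]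
  have hφ' : Nat.card φ.ker * Nat.card X = Nat.card K := by
    rw [← AddSubgroup.card_mul_index φ.ker, AddSubgroup.index_ker,
      AddMonoidHom.range_eq_top.2 hφ, AddSubgroup.card_top]
  have hle : ψ.range ≤ φ.ker := by
    rintro _ ⟨⟨u, w⟩, rfl⟩
    exact add_mem (h1 u.2) (h2 w.2)
  have h3 : Nat.card ψ.range ≤ Nat.card φ.ker := AddSubgroup.card_le_of_le hle
  have hker : ∀ p : ψ.ker, (p.1.1 : K) = -(p.1.2 : K) := fun p =>
    eq_neg_of_add_eq_zero_left p.2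
  have h4 : Nat.card ψ.ker ≤ Nat.card (Ha ⊓ Hb : AddSubgroup K) := by
    refine Nat.card_le_card_of_injective
      (fun p : ψ.ker => ⟨(p.1.1 : K), p.1.1.2, by
        change (p.1.1 : K) ∈ Hb
        rw [hker p]; exact Hb.neg_mem p.1.2.2⟩) ?_
    intro p q hpq
    have h5 : (p.1.1 : K) = q.1.1 := 
      congrArg (fun x : (Ha ⊓ Hb : AddSubgroup K) => (x : K)) hpq
    have h6 : (p.1.2 : K) = q.1.2 := by
      rw [hker p, hker q] at h5
      exact neg_injective h5
    exact Subtype.ext (Prod.ext (Subtype.ext h5) (Subtype.ext h6))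
  rw [← hψ, ← hφ']
  calc _ ≤ Nat.card X * (Nat.card (Ha ⊓ Hb : AddSubgroup K) * Nat.card φ.ker) := by gcongr
    _ = _ := by ring

end SubgroupMatrix

/-! ### Menger's theorem from Hall's marriage theorem. -/

section Linking

open Relation

variable {U : Type*}

/-- Predecessors are unique and elements of A have none, so walking back from u determines the start
in A. -/
theorem eq_of_reflTransGen_of_leftUnique {step : U → U → Prop} {A : Finset U}
    (hA : ∀ u w, step u w → w ∉ A) (hl : ∀ u u' w, step u w → step u' w → u = u') {a a' u : U}
    (ha : a ∈ A) (ha' : a' ∈ A) (h : ReflTransGen step a u) (h' : ReflTransGen step a' u) :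
    a = a' := by
  induction h with
  | refl =>
    rcases h'.cases_tail with h | ⟨v, -, h⟩
    · exact h
    · exact absurd ha (hA _ _ h)
  | tail _ hs ih =>
    rcases h'.cases_tail with rfl | ⟨v, hv, h⟩
    · exact absurd ha' (hA _ _ hs)
    · rw [hl _ _ _ h hs] at hv
      exact ih hv

open Classical in
/-- A form of Menger's theorem: under a Hall condition there are chains, backward deterministic
and hence disjoint, that link at least `m` elements of `A` to elements of `B`. -/
theorem exists_linking [Fintype U] [DecidableEq U] (A B : Finset U) (R : U → U → Prop) (m : ℕ)
    (H : ∀ X : Finset U, Disjoint X B → X.card + m ≤ A.card +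
      (Finset.univ.filter fun w => w ∉ A ∧ (w ∈ X ∨ ∃ u ∈ X, R u w)).card) :
    ∃ step : U → U → Prop, (∀ u w, step u w → w ∉ A ∧ (u = w ∨ R u w)) ∧
      (∀ u u' w, step u w → step u' w → u = u') ∧
      m ≤ (A.filter fun a => ∃ b ∈ B, ReflTransGen step a b).card := by
  have hm : m ≤ A.card := by simpa using H ∅ (by simp)
  -- Every u outside B must choose a successor outside A: itself if idle, an R-neighbour, or one of
  -- |A| - m dummies. The dummies absorb the chains that are allowed to miss B.
  let t : {u // u ∉ B} → Finset (U ⊕ Fin (A.card - m)) := fun u =>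
    (Finset.univ.filter fun w => w ∉ A ∧ (u.1 = w ∨ R u.1 w)).disjSum Finset.univ
  have hall : ∀ s : Finset {u // u ∉ B}, s.card ≤ (s.biUnion t).card := by
    intro s
    rcases s.eq_empty_or_nonempty with rfl | ⟨u₀, hu₀⟩
    · simp
    have h1 := H (s.map (Function.Embedding.subtype _)) (by
      rw [Finset.disjoint_left]
      intro x hx
      obtain ⟨u, -, rfl⟩ := Finset.mem_map.1 hx
      exact u.2)
    have h2 : ((Finset.univ.filter fun w => w ∉ A ∧ (w ∈ s.map (Function.Embedding.subtype _) ∨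
        ∃ u ∈ s.map (Function.Embedding.subtype _), R u w)).disjSum
          (Finset.univ : Finset (Fin (A.card - m)))) ⊆ s.biUnion t := by
      intro x hx
      rw [Finset.mem_biUnion]
      rcases Finset.mem_disjSum.1 hx with ⟨w, hw, rfl⟩ | ⟨i, -, rfl⟩
      · obtain ⟨hwA, hw⟩ := (Finset.mem_filter.1 hw).2
        rcases hw with hw | ⟨u, hu, hw⟩
        · obtain ⟨u, hu, rfl⟩ := Finset.mem_map.1 hw
          exact ⟨u, hu, Finset.inl_mem_disjSum.2 (Finset.mem_filter.2
            ⟨Finset.mem_univ _, hwA, Or.inl rfl⟩)⟩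
        · obtain ⟨u', hu', rfl⟩ := Finset.mem_map.1 hu
          exact ⟨u', hu', Finset.inl_mem_disjSum.2 (Finset.mem_filter.2
            ⟨Finset.mem_univ _, hwA, Or.inr hw⟩)⟩
      · exact ⟨u₀, hu₀, Finset.inr_mem_disjSum.2 (Finset.mem_univ _)⟩
    have h3 := Finset.card_le_card h2
    rw [Finset.card_disjSum, Finset.card_fin] at h3
    rw [Finset.card_map] at h1
    omega
  obtain ⟨f, hf, hft⟩ := (Finset.all_card_le_biUnion_card_iff_exists_injective t).1 hall
  let step : U → U → Prop := fun u w => ∃ h : u ∉ B, f ⟨u, h⟩ = Sum.inl w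
  have hstep : ∀ u w, step u w → w ∉ A ∧ (u = w ∨ R u w) := by
    rintro u w ⟨h, hw⟩
    have := hft ⟨u, h⟩
    rw [hw] at this
    exact (Finset.mem_filter.1 (Finset.inl_mem_disjSum.1 this)).2
  have hleft : ∀ u u' w, step u w → step u' w → u = u' := by
    rintro u u' w ⟨h, hw⟩ ⟨h', hw'⟩
    exact congrArg Subtype.val (hf (hw.trans hw'.symm))
  refine ⟨step, hstep, hleft, ?_⟩
  have hex : ∀ a : {a // a ∈ A.filter fun a => ¬ ∃ b ∈ B, ReflTransGen step a b},
      ∃ i : Fin (A.card - m), ∃ u, ∃ h : u ∉ B, ReflTransGen step a.1 u ∧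
        f ⟨u, h⟩ = Sum.inr i := by
    rintro ⟨a, ha⟩
    obtain ⟨haA, hab⟩ := Finset.mem_filter.1 ha
    by_contra! hcon
    -- If the chain from a met neither B nor a dummy, the successor map would be an injective, hence
    -- surjective, self-map of the finite set Y; but a has no predecessor.
    let Y := {u // ReflTransGen step a u}
    have hYB : ∀ y : Y, y.1 ∉ B := fun y hy => hab ⟨y.1, hy, y.2⟩
    have hnext : ∀ y : Y, ∃ w, f ⟨y.1, hYB y⟩ = Sum.inl w := by
      intro y
      rcases hfy : f ⟨y.1, hYB y⟩ with w | i
      · exact ⟨w, rfl⟩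
      · exact absurd hfy (hcon i y.1 (hYB y) y.2)
    choose g hg using hnext
    let g' : Y → Y := fun y => ⟨g y, y.2.tail ⟨hYB y, hg y⟩⟩
    have hg' : Function.Injective g' := by
      intro y y' hyy
      have h : g y = g y' := congrArg Subtype.val hyy
      have h1 := hf ((hg y).trans ((congrArg Sum.inl h).trans (hg y').symm))
      exact Subtype.ext (congrArg Subtype.val h1 :)
    obtain ⟨y, hy⟩ := Finite.surjective_of_injective hg' ⟨a, ReflTransGen.refl⟩
    have h : g y = a := congrArg Subtype.val hy
    exact (hstep y.1 a ⟨hYB y, by rw [hg y, h]⟩).1 haA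
  choose i u hu hau hfu using hex
  have hinj : Function.Injective i := by
    intro a a' haa
    have h1 := hf ((hfu a).trans ((congrArg Sum.inr haa).trans (hfu a').symm))
    have h2 : u a = u a' := congrArg Subtype.val h1
    exact Subtype.ext (eq_of_reflTransGen_of_leftUnique (fun u w h => (hstep u w h).1) hleft
      (Finset.mem_filter.1 a.2).1 (Finset.mem_filter.1 a'.2).1 (hau a) (h2 ▸ hau a'))
  have hcard := Fintype.card_le_of_injective i hinj
  rw [Fintype.card_coe, Fintype.card_fin] at hcard
  have := Finset.card_filter_add_card_filter_not (s := A)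
    (fun a => ∃ b ∈ B, ReflTransGen step a b)
  omega

end Linking

namespace OpenGraph

open Relation Matrix

variable {V S T E : Type*} (G : OpenGraph V S T E)

/-! ### The Hall condition from edge cuts. -/

section Cuts

variable [Fintype E] (k : E → ℕ)

open Classical in
/-- The unit edges that belong to an edge in the range of `f`. -/
noncomputable def unitEdgesOver {S : Type*} (f : S → E) : Finset (Σ e, Fin (k e)) :=
  Finset.univ.filter fun u => ∃ s, f s = u.1

theorem mem_unitEdgesOver {S : Type*} {f : S → E} {u : Σ e, Fin (k e)} :
    u ∈ unitEdgesOver k f ↔ ∃ s, f s = u.1 := by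
  simp [unitEdgesOver]

/-- Two unit edges are adjacent if they share a vertex. -/
def UnitAdj (u w : Σ e, Fin (k e)) : Prop :=
  ∃ v b b', G.att (u.1, b) = Sum.inl v ∧ G.att (w.1, b') = Sum.inl v

-- The cut to use has the inputs and all vertices touched by X on the input side. Its unit edges
-- avoid X and lie in A or in the neighbourhood N of X, so m ≤ |A \ X| + |N \ X|; the bound follows
-- from X \ A ⊆ N ∩ X.
open Classical in
theorem card_add_le_of_isEdgeCut [DecidableEq E] {m : ℕ} (hm : ∀ C, G.IsEdgeCut C → m ≤ ∑ e ∈ C, k e)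
    (X : Finset (Σ e, Fin (k e))) (hX : Disjoint X (unitEdgesOver k G.outEdge)) :
    X.card + m ≤ (unitEdgesOver k G.inEdge).card +
      (Finset.univ.filter fun w => w ∉ unitEdgesOver k G.inEdge ∧
        (w ∈ X ∨ ∃ u ∈ X, G.UnitAdj k u w)).card := by
  set A := unitEdgesOver k G.inEdge with hA
  set N := Finset.univ.filter fun w => w ∉ A ∧ (w ∈ X ∨ ∃ u ∈ X, G.UnitAdj k u w) with hN
  let side : V ⊕ (S ⊕ T) → Bool :=
    Sum.elim (fun v => decide (∃ u ∈ X, ∃ b, G.att (u.1, b) = Sum.inl v))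
      (Sum.elim (fun _ => true) fun _ => false)
  let C : Finset E := Finset.univ.filter fun e => side (G.att (e, false)) ≠ side (G.att (e, true))
  have hC : m ≤ ∑ e ∈ C, k e := hm C ⟨side, fun _ => rfl, fun _ => rfl, fun e => by simp [C]⟩
  have hsub : C.sigma (fun e => (Finset.univ : Finset (Fin (k e)))) ⊆ (A \ X) ∪ (N \ X) := by
    rintro ⟨e, i⟩ he
    have he' : side (G.att (e, false)) ≠ side (G.att (e, true)) :=
      (Finset.mem_filter.1 (Finset.mem_sigma.1 he).1).2
    obtain ⟨b, hb, hb'⟩ : ∃ b, side (G.att (e, b)) = true ∧ side (G.att (e, !b)) = false := by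
      cases h : side (G.att (e, false)) <;> cases h' : side (G.att (e, true))
      · simp [h, h'] at he'
      · exact ⟨true, h', h⟩
      · exact ⟨false, h, h'⟩
      · simp [h, h'] at he'
    have hnX : (⟨e, i⟩ : Σ e, Fin (k e)) ∉ X := by
      intro hmem
      rcases hatt : G.att (e, !b) with v | s | t
      · rw [hatt] at hb'
        exact of_decide_eq_false hb' ⟨_, hmem, _, hatt⟩
      · rw [hatt] at hb'
        exact absurd hb' (by simp [side])
      · refine Finset.disjoint_left.1 hX hmem ((mem_unitEdgesOver k).2 ⟨t, ?_⟩)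
        rw [outEdge, ← (G.att_eq_inr_iff _ _).1 hatt]
    rw [Finset.mem_union, Finset.mem_sdiff, Finset.mem_sdiff]
    by_cases heA : (⟨e, i⟩ : Σ e, Fin (k e)) ∈ A
    · exact Or.inl ⟨heA, hnX⟩
    · refine Or.inr ⟨?_, hnX⟩
      rcases hatt : G.att (e, b) with v | s | t
      · rw [hatt] at hb
        obtain ⟨u, hu, b', hb'⟩ := of_decide_eq_true hb
        exact Finset.mem_filter.2 ⟨Finset.mem_univ _, heA, Or.inr ⟨u, hu, v, b', b, hb', hatt⟩⟩
      · refine absurd ((mem_unitEdgesOver k).2 ⟨s, ?_⟩) heA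
        rw [inEdge, ← (G.att_eq_inr_iff _ _).1 hatt]
      · rw [hatt] at hb
        exact absurd hb (by simp [side])
  have h1 := Finset.card_le_card hsub
  rw [Finset.card_sigma] at h1
  simp only [Finset.card_fin] at h1
  have h2 := Finset.card_union_le (A \ X) (N \ X)
  have h3 := Finset.card_sdiff_add_card_inter A X
  have h4 := Finset.card_sdiff_add_card_inter N X
  have h5 := Finset.card_sdiff_add_card_inter X A
  have h6 : (X \ A).card ≤ (N ∩ X).card := Finset.card_le_card fun u hu => by
    obtain ⟨hu1, hu2⟩ := Finset.mem_sdiff.1 hu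
    exact Finset.mem_inter.2 ⟨Finset.mem_filter.2 ⟨Finset.mem_univ _, hu2, Or.inl hu1⟩, hu1⟩
  rw [Finset.inter_comm X A] at h5
  omega

end Cuts

/-! ### Labelings constant along chains. -/

section Chains

variable {U F : Type*} [AddCommGroup F]

/-- The labelings of `U` that are constant along a relation. -/
def compatible (F : Type*) [AddCommGroup F] (step : U → U → Prop) : AddSubgroup (U → F) where
  carrier := {W | ∀ u w, step u w → W u = W w}
  add_mem' := fun h h' u w hs => by simp [h u w hs, h' u w hs]
  zero_mem' := fun _ _ _ => rfl
  neg_mem' := fun h u w hs => by simp [h u w hs]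

/-- The labelings that vanish on `P`. -/
def vanishing (K : AddSubgroup (U → F)) (P : Finset U) : AddSubgroup K where
  carrier := {W | ∀ u ∈ P, W.1 u = 0}
  add_mem' := fun h h' u hu => by simp [h u hu, h' u hu]
  zero_mem' := fun _ _ => rfl
  neg_mem' := fun h u hu => by simp [h u hu]

-- Restriction to the linked starts P kills labelings vanishing on A since P ⊆ A, and those
-- vanishing on B since values propagate along the chains. Hence `card_mul_card_mul_card_le`
-- applies.
open Classical in
theorem card_pow_mul_card_vanishing_le [Fintype U] [Fintype F] {step : U → U → Prop}
    {A B : Finset U} (hA : ∀ u w, step u w → w ∉ A)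
    (hl : ∀ u u' w, step u w → step u' w → u = u') {m : ℕ}
    (hm : m ≤ (A.filter fun a => ∃ b ∈ B, ReflTransGen step a b).card) :
    Fintype.card F ^ m * (Nat.card (vanishing (compatible F step) A) *
      Nat.card (vanishing (compatible F step) B)) ≤
      Nat.card (compatible F step) *
        Nat.card (vanishing (compatible F step) A ⊓ vanishing (compatible F step) B :
          AddSubgroup (compatible F step)) := by
  set P := A.filter fun a => ∃ b ∈ B, ReflTransGen step a b with hP
  let φ : compatible F step →+ (P → F) :=
    { toFun := fun W a => W.1 a
      map_zero' := rfl
      map_add' := fun _ _ => rfl }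
  have hsurj : Function.Surjective φ := by
    intro x
    -- Spread each x a over all that a reaches. Reachability from a is invariant along `step` in
    -- both directions because predecessors are unique.
    refine ⟨⟨fun u => ∑ a : P, if ReflTransGen step a u then x a else 0, ?_⟩, ?_⟩
    · intro u w hs
      refine Finset.sum_congr rfl fun a _ => ?_
      have : ReflTransGen step a u ↔ ReflTransGen step a w := by
        refine ⟨fun h => h.tail hs, fun h => ?_⟩
        rcases h.cases_tail with rfl | ⟨v, hv, h⟩
        · exact absurd (Finset.mem_filter.1 a.2).1 (hA _ _ hs)
        · rwa [hl _ _ _ h hs] at hv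
      simp only [this]
    · funext a
      change (∑ a' : P, if ReflTransGen step a' a then x a' else 0) = x a
      rw [Finset.sum_eq_single a]
      · rw [if_pos ReflTransGen.refl]
      · intro a' _ hne
        rw [if_neg]
        intro h
        exact hne (Subtype.ext (eq_of_reflTransGen_of_leftUnique hA hl
          (Finset.mem_filter.1 a'.2).1 (Finset.mem_filter.1 a.2).1 h ReflTransGen.refl))
      · simp
  have hkA : vanishing (compatible F step) A ≤ φ.ker := fun W hW =>
    funext fun a => hW a (Finset.mem_filter.1 a.2).1
  have hkB : vanishing (compatible F step) B ≤ φ.ker := fun W hW => funext fun a => by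
    obtain ⟨b, hb, hab⟩ := (Finset.mem_filter.1 a.2).2
    have : W.1 a = W.1 b := by
      clear hb
      induction hab with
      | refl => rfl
      | tail _ hs ih => rw [ih, W.2 _ _ hs]
    exact this.trans (hW b hb)
  refine le_trans ?_ (card_mul_card_mul_card_le _ _ φ hsurj hkA hkB)
  gcongr
  rw [Nat.card_eq_fintype_card, Fintype.card_fun, Fintype.card_coe]
  exact Nat.pow_le_pow_right Fintype.card_pos hm

end Chains

/-! ### The 0-1 tensor network and its entropy. -/

section Network

variable {F : Type*} [AddCommGroup F] {c k : E → ℕ} (θ : ∀ e, Fin (c e) ≃ (Fin (k e) → F))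

open Classical in
/-- The 0-1 tensors that force an edge labeling to be constant along `step`. -/
noncomputable def chainTensor (step : (Σ e, Fin (k e)) → (Σ e, Fin (k e)) → Prop) :
    G.TensorAssignment c := fun v I =>
  if ∀ (h h' : G.EndsAt v) (i : Fin (k h.1.1)) (i' : Fin (k h'.1.1)),
    step ⟨h.1.1, i⟩ ⟨h'.1.1, i'⟩ → θ _ (I h) i = θ _ (I h') i' then 1 else 0

/-- Indices for all edges correspond to labelings of all unit edges. -/
def unitLabeling : ((e : E) → Fin (c e)) ≃ ((Σ e, Fin (k e)) → F) :=
  (Equiv.piCongrRight θ).trans (Equiv.piCurry fun _ _ => F).symm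

/-- The index that a labeling of unit edges induces at open edges. -/
def boundaryIdx {S : Type*} (f : S → E) {K : AddSubgroup ((Σ e, Fin (k e)) → F)} (W : K) :
    (s : S) → Fin (c (f s)) :=
  fun s => (θ (f s)).symm fun i => W.1 ⟨f s, i⟩

theorem boundaryIdx_eq_iff [Fintype E] {S : Type*} (f : S → E)
    {K : AddSubgroup ((Σ e, Fin (k e)) → F)} (W W' : K) :
    boundaryIdx θ f W = boundaryIdx θ f W' ↔ W - W' ∈ vanishing K (unitEdgesOver k f) := by
  constructor
  · rintro h ⟨e, i⟩ hu
    obtain ⟨s, rfl⟩ := (mem_unitEdgesOver k).1 hu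
    have h1 := congrFun ((θ (f s)).symm.injective (congrFun h s)) i
    exact sub_eq_zero.2 h1
  · intro h
    funext s
    refine congrArg _ (funext fun i => ?_)
    exact sub_eq_zero.1 (h ⟨f s, i⟩ ((mem_unitEdgesOver k).2 ⟨s, rfl⟩))

-- Local constraints suffice: a step is idle and imposes nothing, or joins unit edges at a common
-- vertex, whose tensor enforces it.
open Classical in
theorem prod_chainTensor [Fintype V] {step : (Σ e, Fin (k e)) → (Σ e, Fin (k e)) → Prop}
    (hstep : ∀ u w, step u w → u = w ∨ G.UnitAdj k u w) (W : (e : E) → Fin (c e)) :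
    ∏ v, G.chainTensor θ step v (fun h => W h.1.1) =
      if unitLabeling θ W ∈ compatible F step then 1 else 0 := by
  simp only [chainTensor]
  rw [Finset.prod_boole]
  congr 1
  refine propext ⟨fun h u w hs => ?_, fun h v _ x x' i i' hs => h _ _ hs⟩
  rcases hstep u w hs with rfl | ⟨v, b, b', hb, hb'⟩
  · rfl
  · exact h v (Finset.mem_univ _) ⟨_, hb⟩ ⟨_, hb'⟩ u.2 w.2 hs

/-- Both sides count the compatible labelings with prescribed boundary indices I and J. -/
theorem contract_chainTensor [Fintype V] [Fintype S] [Fintype T] [Fintype E] [DecidableEq E]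
    [Fintype F] {step : (Σ e, Fin (k e)) → (Σ e, Fin (k e)) → Prop}
    [Fintype (compatible F step)]
    (hstep : ∀ u w, step u w → u = w ∨ G.UnitAdj k u w) :
    G.contract c (G.chainTensor θ step) =
      (graphMatrix (boundaryIdx θ G.inEdge (K := compatible F step)))ᴴ *
        graphMatrix (boundaryIdx θ G.outEdge (K := compatible F step)) := by
  classical
  ext I J
  simp only [contract, G.prod_chainTensor θ hstep, Matrix.mul_apply, Matrix.conjTranspose_apply,
    graphMatrix]
  rw [Finset.sum_filter, ← Equiv.sum_comp (unitLabeling θ).symm]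
  simp only [Equiv.apply_symm_apply]
  let f : ((Σ e, Fin (k e)) → F) → ℂ := fun W =>
    if G.Extends c ((unitLabeling θ).symm W) I J then 1 else 0
  calc _ = ∑ W with W ∈ compatible F step, f W := by
        rw [Finset.sum_filter]
        refine Finset.sum_congr rfl fun W _ => ?_
        by_cases h : W ∈ compatible F step <;> simp [f, h]
    _ = ∑ W : compatible F step, f W := Finset.sum_subtype _ (by simp) f
    _ = _ := by
        refine Finset.sum_congr rfl fun W _ => ?_
        have hI : boundaryIdx θ G.inEdge W = I ↔
            ∀ s, (unitLabeling θ).symm W.1 (G.inEdge s) = I s := funext_iff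
        have hJ : boundaryIdx θ G.outEdge W = J ↔
            ∀ t, (unitLabeling θ).symm W.1 (G.outEdge t) = J t := funext_iff
        simp only [f, Extends, ← hI, ← hJ]
        by_cases h1 : boundaryIdx θ G.inEdge W = I <;>
          by_cases h2 : boundaryIdx θ G.outEdge W = J <;> simp [h1, h2]

theorem exists_chainTensor_entropy [Fintype V] [Fintype S] [Fintype T] [Fintype E]
    [DecidableEq S] [DecidableEq T] [DecidableEq E] [Fintype F]
    (θ : ∀ e, Fin (c e) ≃ (Fin (k e) → F)) {m : ℕ}
    (hm : ∀ C, G.IsEdgeCut C → m ≤ ∑ e ∈ C, k e) :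
    ∃ 𝒯 : G.TensorAssignment c, (∀ v I, 𝒯 v I = 0 ∨ 𝒯 v I = 1) ∧ G.contract c 𝒯 ≠ 0 ∧
      Real.log (Fintype.card F ^ m : ℕ) ≤ entanglementEntropy (G.contract c 𝒯) := by
  classical
  obtain ⟨step, hstep, hl, hcard⟩ := exists_linking (unitEdgesOver k G.inEdge)
    (unitEdgesOver k G.outEdge) (G.UnitAdj k) m (G.card_add_le_of_isEdgeCut k hm)
  have hle := card_pow_mul_card_vanishing_le (F := F) (fun u w h => (hstep u w h).1) hl hcard
  have hC := G.contract_chainTensor θ fun u w h => (hstep u w h).2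
  have hiso := conjTranspose_graphMatrix_mul_mul_conjTranspose_mul_self
    (boundaryIdx θ G.inEdge (K := compatible F step)) (boundaryIdx θ G.outEdge) _ _
    (boundaryIdx_eq_iff θ G.inEdge) (boundaryIdx_eq_iff θ G.outEdge)
  have hnorm := sum_norm_sq_conjTranspose_graphMatrix_mul
    (boundaryIdx θ G.inEdge (K := compatible F step)) (boundaryIdx θ G.outEdge) _ _
    (boundaryIdx_eq_iff θ G.inEdge) (boundaryIdx_eq_iff θ G.outEdge)
  rw [← hC] at hiso hnorm
  set Ha := vanishing (compatible F step) (unitEdgesOver k G.inEdge)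
  set Hb := vanishing (compatible F step) (unitEdgesOver k G.outEdge)
  have hHa : (0 : ℝ) < Nat.card Ha := by exact_mod_cast Nat.card_pos
  have hHb : (0 : ℝ) < Nat.card Hb := by exact_mod_cast Nat.card_pos
  have hK : (0 : ℝ) < Nat.card (compatible F step) := by exact_mod_cast Nat.card_pos
  have hinf : (0 : ℝ) < Nat.card (Ha ⊓ Hb : AddSubgroup (compatible F step)) := by
    exact_mod_cast Nat.card_pos
  refine ⟨G.chainTensor θ step, fun v I => ?_, fun h0 => ?_, ?_⟩
  · unfold chainTensor
    split_ifs
    · exact Or.inr rfl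
    · exact Or.inl rfl
  · rw [h0] at hnorm
    simp only [Matrix.zero_apply, norm_zero, ne_eq, OfNat.ofNat_ne_zero, not_false_eq_true,
      zero_pow, Finset.sum_const_zero] at hnorm
    exact (mul_pos hK hinf).ne hnorm
  · rw [entanglementEntropy_eq_log_of_mul_conjTranspose_mul_self
      (γ := Nat.card Ha * Nat.card Hb)
      -- This is |K/(Ha+Hb)|, the squared norm divided by γ.
      (D := Nat.card (compatible F step) *
        Nat.card (Ha ⊓ Hb : AddSubgroup (compatible F step)) / (Nat.card Ha * Nat.card Hb))
      (mul_pos hHa hHb) (div_pos (mul_pos hK hinf) (mul_pos hHa hHb)) hiso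
      (by rw [hnorm, div_mul_cancel₀ _ (mul_pos hHa hHb).ne'])]
    refine Real.log_le_log (by exact_mod_cast pow_pos Fintype.card_pos m) ?_
    rw [le_div_iff₀ (mul_pos hHa hHb)]
    exact_mod_cast hle

end Network

/-! ### Minimal cuts and the conclusion. -/

theorem exists_isEdgeCut_quantumMinCut [Fintype E] (G : OpenGraph V S T E) (c : E → ℕ) :
    ∃ C : Finset E, G.IsEdgeCut C ∧ G.quantumMinCut c = ∏ e ∈ C, c e := by
  obtain ⟨C, hC⟩ := G.exists_isEdgeCut
  exact Nat.sInf_mem (s := {m | ∃ C : Finset E, G.IsEdgeCut C ∧ m = ∏ e ∈ C, c e}) ⟨_, C, hC, rfl⟩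

theorem exists_isEdgeCut_forall_sum_le [Fintype E] (G : OpenGraph V S T E) (k : E → ℕ) :
    ∃ C : Finset E, G.IsEdgeCut C ∧ ∀ C', G.IsEdgeCut C' → ∑ e ∈ C, k e ≤ ∑ e ∈ C', k e := by
  classical
  obtain ⟨C, hC⟩ := G.exists_isEdgeCut
  obtain ⟨C₁, h1, h2⟩ := Finset.exists_min_image (Finset.univ.filter fun C => G.IsEdgeCut C)
    (fun C => ∑ e ∈ C, k e) ⟨C, by simpa using hC⟩
  exact ⟨C₁, by simpa using h1, fun C' hC' => h2 C' (by simpa using hC')⟩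

end OpenGraph

theorem theorem5p2 {V S T E : Type*} [Fintype V] [Fintype S] [Fintype T] [Fintype E]
    [DecidableEq S] [DecidableEq T] [DecidableEq E]
    (G : OpenGraph V S T E) (c : E → ℕ)
    (d : ℕ) (hd : 0 < d) (hc : ∀ e, ∃ k : ℕ, c e = d ^ k) :
    IsGreatest (G.entropyValues c) (Real.log (G.quantumMinCut c)) ∧
    ∃ 𝒯 : G.TensorAssignment c,
      (∀ v I, 𝒯 v I = 0 ∨ 𝒯 v I = 1) ∧
      G.contract c 𝒯 ≠ 0 ∧
      entanglementEntropy (G.contract c 𝒯) = Real.log (G.quantumMinCut c) := by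
  choose k hk using hc
  have : NeZero d := ⟨hd.ne'⟩
  have hpos : ∀ e, 0 < c e := fun e => hk e ▸ pow_pos hd _
  obtain ⟨C₀, hC₀, hq⟩ := G.exists_isEdgeCut_quantumMinCut c
  have upper : ∀ 𝒯 : G.TensorAssignment c, G.contract c 𝒯 ≠ 0 →
      entanglementEntropy (G.contract c 𝒯) ≤ Real.log (G.quantumMinCut c) := fun 𝒯 h =>
    entanglementEntropy_le_log_of_rank_le h (hq ▸ G.rank_contract_le c hpos 𝒯 hC₀)
  obtain ⟨C₁, hC₁, hmin⟩ := G.exists_isEdgeCut_forall_sum_le k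
  -- Base-d digits turn an index of the edge into letters on its unit edges.
  have θ : ∀ e, Fin (c e) ≃ (Fin (k e) → ZMod d) := fun e =>
    (finCongr (hk e)).trans
      (finFunctionFinEquiv.symm.trans (Equiv.arrowCongr (Equiv.refl _) (ZMod.finEquiv d).toEquiv))
  obtain ⟨𝒯, h01, hne, hlow⟩ := G.exists_chainTensor_entropy θ hmin
  -- Only this inequality is needed, since the upper bound closes the gap. So it does no harm that
  -- for d = 1 the exponents are not determined by `c`.
  have hle : G.quantumMinCut c ≤ Fintype.card (ZMod d) ^ ∑ e ∈ C₁, k e := by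
    have h : G.quantumMinCut c ≤ ∏ e ∈ C₁, c e := Nat.sInf_le ⟨C₁, hC₁, rfl⟩
    refine h.trans_eq ?_
    rw [ZMod.card, ← Finset.prod_pow_eq_pow_sum]
    exact Finset.prod_congr rfl fun e _ => hk e
  have hqpos : 0 < G.quantumMinCut c := hq ▸ Finset.prod_pos fun e _ => hpos e
  have heq : entanglementEntropy (G.contract c 𝒯) = Real.log (G.quantumMinCut c) :=
    le_antisymm (upper 𝒯 hne) (le_trans
      (Real.log_le_log (by exact_mod_cast hqpos) (by exact_mod_cast hle)) hlow)
  refine ⟨⟨⟨𝒯, hne, heq.symm⟩, ?_⟩, 𝒯, h01, hne, heq⟩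
  rintro x ⟨𝒯', hne', rfl⟩
  exact upper 𝒯' hne'
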